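/- Let $N\in\mathbb N_0$, let $\Omega\subset\mathbb R^N$ be an open set and let $p\in(1,\infty)$. Let $W^{1,p}(\Omega)$ be the space of all real-valued $u\in L^p(\Omega)$ whose first order distributional partial derivatives $\partial_1u,\dots,\partial_Nu$ belong to $L^p(\Omega)$, with the norm given by $$\|u\|_{W^{1,p}(\Omega)}^p:=\|u\|_{L^p(\Omega)}^p+\sum_{i=1}^N\|\partial_i u\|_{L^p(\Omega)}^p ,$$ and let $\tilde W^{1,p}(\Omega)$ be the closure in $W^{1,p}(\Omega)$ of the set of those functions in $W^{1,p}(\Omega)$ that are restrictions to $\Omega$ of continuous functions $\overline\Omega\to\mathbb R$ with compact support. For $A\subset\overline\Omega$ let $\mathcal Y_{p,\Omega}(A)$ be the set of all $u\in\tilde W^{1,p}(\Omega)$ for which there is a relatively open subset $O$ of $\overline\Omega$ such that $A\subset O$ and $u\ge 1$ almost everywhere on $O\cap\Omega$ (with respect to Lebesgue measure). The relative $p$-capacity of $A$ is $$\mathrm{Cap}_{p,\Omega}(A):=\inf\{\|u\|_{W^{1,p}(\Omega)}^p : u\in\mathcal Y_{p,\Omega}(A)\}\in[0,\infty],\qquad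 \inf\emptyset:=\infty .$$ Then the relative $p$-capacity is countably subadditive: for every sequence $(A_k)_{k\in\mathbb N}$ of subsets of $\overline\Omega$, $$\mathrm{Cap}_{p,\Omega}\Big(\bigcup_{k\in\mathbb N}A_k\Big)\le\sum_{k\in\mathbb N}\mathrm{Cap}_{p,\Omega}(A_k)\in[0,\infty].$$ -/

import Mathlib

open MeasureTheory TopologicalSpace
open scoped ENNReal Distributions CompactlySupported

noncomputable section

namespace RelCap

/-- `ℝ^N` with the Euclidean norm. -/
abbrev RN (N : ℕ) : Type := EuclideanSpace ℝ (Fin N)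

/-- `g` is the `i`-th partial derivative of `u` in the sense of distributions on `Ω`:
`∫_Ω u ∂ᵢφ = - ∫_Ω g φ` for every test function `φ ∈ 𝓓(Ω)`.
Functions on `Ω` are represented by functions on `ℝ^N` whose values outside `Ω` play no role. -/
def HasWeakPartialDeriv {N : ℕ} (Ω : Opens (RN N)) (i : Fin N) (u g : RN N → ℝ) : Prop :=
  ∀ φ : 𝓓(Ω, ℝ),
    ∫ x in (Ω : Set (RN N)), u x * fderiv ℝ φ x (EuclideanSpace.single i 1) =
      - ∫ x in (Ω : Set (RN N)), g x * φ x

/-- `v ∈ L^p(Ω)`. -/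
def MemLpOn {N : ℕ} (Ω : Opens (RN N)) (p : ℝ) (v : RN N → ℝ) : Prop :=
  MemLp v (ENNReal.ofReal p) (volume.restrict (Ω : Set (RN N)))

/-- The Sobolev space `W^{1,p}(Ω)`: functions in `L^p(Ω)` all of whose first order distributional
partial derivatives are in `L^p(Ω)`. -/
def sobolevSpace {N : ℕ} (Ω : Opens (RN N)) (p : ℝ) : Set (RN N → ℝ) :=
  {u | MemLpOn Ω p u ∧ ∀ i, ∃ g, MemLpOn Ω p g ∧ HasWeakPartialDeriv Ω i u g}

open Classical in
/-- The `i`-th distributional partial derivative of `u`, as an element of `L^p(Ω)`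
(a representative of it, which is unique up to null sets; `0` if there is none). -/
def weakPartialDeriv {N : ℕ} (Ω : Opens (RN N)) (p : ℝ) (i : Fin N) (u : RN N → ℝ) : RN N → ℝ :=
  if h : ∃ g, MemLpOn Ω p g ∧ HasWeakPartialDeriv Ω i u g then h.choose else 0

/-- The `p`-th power of the Sobolev norm of `u ∈ W^{1,p}(Ω)`:
`‖u‖_{W^{1,p}(Ω)}^p = ‖u‖_{L^p(Ω)}^p + ∑ᵢ ‖∂ᵢu‖_{L^p(Ω)}^p`. -/
def sobolevNormPow {N : ℕ} (Ω : Opens (RN N)) (p : ℝ) (u : RN N → ℝ) : ℝ≥0∞ :=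
  eLpNorm u (ENNReal.ofReal p) (volume.restrict (Ω : Set (RN N))) ^ p +
    ∑ i, eLpNorm (weakPartialDeriv Ω p i u) (ENNReal.ofReal p)
      (volume.restrict (Ω : Set (RN N))) ^ p

/-- The functions in `W^{1,p}(Ω)` that are restrictions to `Ω` of some function in
`C_c(closure Ω)`. -/
def sobolevCc {N : ℕ} (Ω : Opens (RN N)) (p : ℝ) : Set (RN N → ℝ) :=
  {v | v ∈ sobolevSpace Ω p ∧
    ∃ w : C_c(closure (Ω : Set (RN N)), ℝ),
      ∀ x : closure (Ω : Set (RN N)), (x : RN N) ∈ Ω → v x = w x}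

/-- The closure of `W^{1,p}(Ω) ∩ C_c(closure Ω)` in `W^{1,p}(Ω)`. -/
def sobolevTilde {N : ℕ} (Ω : Opens (RN N)) (p : ℝ) : Set (RN N → ℝ) :=
  {u | u ∈ sobolevSpace Ω p ∧
    ∀ ε : ℝ≥0∞, 0 < ε → ∃ v ∈ sobolevCc Ω p, sobolevNormPow Ω p (u - v) < ε}

/-- The functions admissible for `A ⊆ closure Ω`: those `u` in `sobolevTilde Ω p` for which there
is a relatively open set `O ⊆ closure Ω` containing `A` with `u ≥ 1` a.e. on `O ∩ Ω`. -/
def admissible {N : ℕ} (Ω : Opens (RN N)) (p : ℝ) (A : Set (closure (Ω : Set (RN N)))) :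
    Set (RN N → ℝ) :=
  {u | u ∈ sobolevTilde Ω p ∧
    ∃ O : Set (closure (Ω : Set (RN N))), IsOpen O ∧ A ⊆ O ∧
      ∀ᵐ x : RN N, x ∈ (Subtype.val '' O) ∩ (Ω : Set (RN N)) → 1 ≤ u x}

/-- The relative `p`-capacity of `A ⊆ closure Ω`, with `inf ∅ = ∞`. -/
def relCapacity {N : ℕ} (Ω : Opens (RN N)) (p : ℝ) (A : Set (closure (Ω : Set (RN N)))) : ℝ≥0∞ :=
  ⨅ u ∈ admissible Ω p A, sobolevNormPow Ω p u

end RelCap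

end

/-! Assume the right-hand side is finite, and choose admissible `u k` for `A k` whose norm powers
exceed the capacities by at most `δ k`, with the `δ k` summing to less than `ε`. Positive parts stay
above 1 where needed and do not increase the norm, so each `u k` may be replaced by its positive
part. The competitor for the union is then the supremum `w` of these nonnegative functions.

At almost every point, `w` and its gradient coincide with the value and gradient of one single `u
k`. Hence `|w|^p` and `|∂ᵢw|^p` are bounded pointwise by the sums over `k` of `|u k|^p` and `|∂ᵢ u
k|^p`; integrating gives the norm estimate with constant 1 (`exists_mem_sobolevTilde_ge`).

The remaining point is that `w` belongs to the closed subspace `sobolevTilde`. Summability forces `u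
k x → 0` almost everywhere, so the finite maxima, together with their gradients, are eventually
constant in `n` at almost every `x`. Dominated convergence turns this into convergence in the
Sobolev norm.

Finite maxima reduce to positive parts through `max u v = u + (v - u)⁺`. The gradient of `u⁺` comes
from a chain rule proved by mollification (`HasWeakPartialDeriv.comp`), and `sobolevTilde_posPart`
shows that the closure of the continuous functions is stable under positive parts. -/

namespace RelCap

open Filter Topology Convolution ContinuousLinearMap

/-! ### L¹ convergence and derivatives of mollifications -/

section Mollification

/-- Scheffé's lemma for functions with constant integral. -/
theorem tendsto_integral_abs_sub_of_nonneg {α : Type*} [MeasurableSpace α] {μ : Measure α}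
    {f : ℕ → α → ℝ} {g : α → ℝ} (hf : ∀ n, Integrable (f n) μ) (hg : Integrable g μ)
    (hf0 : ∀ n x, 0 ≤ f n x) (hg0 : ∀ x, 0 ≤ g x) (hfg : ∀ n, ∫ x, f n x ∂μ = ∫ x, g x ∂μ)
    (hlim : ∀ᵐ x ∂μ, Tendsto (fun n => f n x) atTop (𝓝 (g x))) :
    Tendsto (fun n => ∫ x, |f n x - g x| ∂μ) atTop (𝓝 0) := by
  -- Only the positive part of `g - f n` is dominated, namely by `g`. Equality of the integrals
  -- makes it carry exactly half of the L¹ distance.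
  have hmain : Tendsto (fun n => ∫ x, max (g x - f n x) 0 ∂μ) atTop (𝓝 (∫ _, (0 : ℝ) ∂μ)) := by
    refine tendsto_integral_of_dominated_convergence g
      (fun n => (hg.sub (hf n)).pos_part.aestronglyMeasurable) hg (fun n => ae_of_all _ fun x => ?_)
      ?_
    · rw [Real.norm_of_nonneg (le_max_right _ _)]
      exact max_le (by linarith [hf0 n x]) (hg0 x)
    · filter_upwards [hlim] with x hx
      have h := (tendsto_const_nhds (x := g x)).sub hx
      simpa using h.max (tendsto_const_nhds (x := (0 : ℝ)))
  have heq : ∀ n, ∫ x, |f n x - g x| ∂μ = 2 * ∫ x, max (g x - f n x) 0 ∂μ := by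
    intro n
    have h1 : ∀ x, |f n x - g x| = 2 * max (g x - f n x) 0 + (f n x - g x) := by
      intro x
      rcases le_total (f n x) (g x) with h | h
      · rw [abs_of_nonpos (by linarith), max_eq_left (by linarith)]; ring
      · rw [abs_of_nonneg (by linarith), max_eq_right (by linarith)]; ring
    simp_rw [h1]
    have h2 : Integrable (fun x => 2 * max (g x - f n x) 0) μ :=
      (hg.sub (hf n)).pos_part.const_mul 2
    have h3 : Integrable (fun x => f n x - g x) μ := (hf n).sub hg
    rw [integral_add h2 h3, integral_const_mul, integral_sub (hf n) hg, hfg n]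
    simp
  simp_rw [heq]
  simpa using hmain.const_mul 2

variable {E : Type*} [NormedAddCommGroup E] [NormedSpace ℝ E] [FiniteDimensional ℝ E]
  [MeasurableSpace E] [BorelSpace E] {μ : Measure E} [μ.IsAddHaarMeasure]

theorem integrable_normed_convolution (ρ : ContDiffBump (0 : E)) {g : E → ℝ}
    (hg : Integrable g μ) : Integrable (ρ.normed μ ⋆[lsmul ℝ ℝ, μ] g) μ :=
  Integrable.integrable_convolution _
    (ρ.continuous_normed.integrable_of_hasCompactSupport ρ.hasCompactSupport_normed) hg

theorem normed_convolutionExistsAt (ρ : ContDiffBump (0 : E)) {g : E → ℝ}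
    (hg : Integrable g μ) (x : E) : ConvolutionExistsAt (ρ.normed μ) g x (lsmul ℝ ℝ) μ :=
  ρ.hasCompactSupport_normed.convolutionExists_left _ ρ.continuous_normed hg.locallyIntegrable x

theorem integral_normed_convolution (ρ : ContDiffBump (0 : E)) {g : E → ℝ}
    (hg : Integrable g μ) :
    ∫ x, (ρ.normed μ ⋆[lsmul ℝ ℝ, μ] g) x ∂μ = ∫ x, g x ∂μ := by
  rw [integral_convolution (lsmul ℝ ℝ)
    (ρ.continuous_normed.integrable_of_hasCompactSupport ρ.hasCompactSupport_normed) hg,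
    ρ.integral_normed]
  simp

/-- Mollifications of an integrable function converge to it in `L¹`. -/
theorem tendsto_integral_abs_normed_convolution_sub {ρ : ℕ → ContDiffBump (0 : E)} {K : ℝ}
    (hρ : Tendsto (fun n => (ρ n).rOut) atTop (𝓝 0)) (hK : ∀ n, (ρ n).rOut ≤ K * (ρ n).rIn)
    {g : E → ℝ} (hg : Integrable g μ) :
    Tendsto (fun n => ∫ x, |((ρ n).normed μ ⋆[lsmul ℝ ℝ, μ] g) x - g x| ∂μ) atTop (𝓝 0) := by
  -- Mollification preserves nonnegativity and the integral, so Scheffé's lemma applies to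
  -- nonnegative functions; the general case splits `g` into positive and negative parts.
  have key : ∀ h : E → ℝ, Integrable h μ → (∀ x, 0 ≤ h x) →
      Tendsto (fun n => ∫ x, |((ρ n).normed μ ⋆[lsmul ℝ ℝ, μ] h) x - h x| ∂μ) atTop (𝓝 0) := by
    intro h hh hh0
    refine tendsto_integral_abs_sub_of_nonneg (fun n => integrable_normed_convolution (ρ n) hh) hh
      (fun n x => ?_) hh0 (fun n => integral_normed_convolution (ρ n) hh)
      (ContDiffBump.ae_convolution_tendsto_right_of_locallyIntegrable hρ
        (Eventually.of_forall hK) hh.locallyIntegrable)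
    exact integral_nonneg fun t => mul_nonneg ((ρ n).nonneg_normed t) (hh0 _)
  have hp := hg.pos_part
  have hn := hg.neg_part
  have h1 := (key _ hp fun x => le_max_right _ _).add (key _ hn fun x => le_max_right _ _)
  rw [add_zero] at h1
  refine squeeze_zero (fun n => integral_nonneg fun x => abs_nonneg _) (fun n => ?_) h1
  have hint : ∀ h : E → ℝ, Integrable h μ →
      Integrable (fun x => |((ρ n).normed μ ⋆[lsmul ℝ ℝ, μ] h) x - h x|) μ :=
    fun h hh => ((integrable_normed_convolution (ρ n) hh).sub hh).abs
  rw [← integral_add (hint _ hp) (hint _ hn)]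
  refine integral_mono (hint _ hg) ((hint _ hp).add (hint _ hn)) fun x => ?_
  have hdec : g = (fun x => max (g x) 0) - fun x => max (-g x) 0 := by
    funext y
    rcases le_total (g y) 0 with h | h <;> simp [h]
  have hconv : ((ρ n).normed μ ⋆[lsmul ℝ ℝ, μ] g) x =
      ((ρ n).normed μ ⋆[lsmul ℝ ℝ, μ] fun x => max (g x) 0) x -
        ((ρ n).normed μ ⋆[lsmul ℝ ℝ, μ] fun x => max (-g x) 0) x := by
    rw [convolution_def, convolution_def, convolution_def,
      ← integral_sub (normed_convolutionExistsAt (ρ n) hp x)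
        (normed_convolutionExistsAt (ρ n) hn x)]
    refine integral_congr_ae (ae_of_all _ fun t => ?_)
    have := congrFun hdec (x - t)
    simp only [Pi.sub_apply] at this
    simp only [lsmul_apply, smul_eq_mul]
    conv_lhs => rw [this]
    ring
  have hgx := congrFun hdec x
  simp only [Pi.sub_apply] at hgx
  calc |((ρ n).normed μ ⋆[lsmul ℝ ℝ, μ] g) x - g x|
      = |(((ρ n).normed μ ⋆[lsmul ℝ ℝ, μ] fun x => max (g x) 0) x - max (g x) 0) -
        (((ρ n).normed μ ⋆[lsmul ℝ ℝ, μ] fun x => max (-g x) 0) x - max (-g x) 0)| := by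
        rw [hconv]; congr 1; linarith
    _ ≤ _ := abs_sub _ _

theorem fderiv_normed_convolution_apply (ρ : ContDiffBump (0 : E)) {g : E → ℝ}
    (hg : LocallyIntegrable g μ) (x v : E) :
    fderiv ℝ (ρ.normed μ ⋆[lsmul ℝ ℝ, μ] g) x v =
      ∫ t, fderiv ℝ (ρ.normed μ) (x - t) v * g t ∂μ := by
  have hρ : ContDiff ℝ 1 (ρ.normed μ) := ρ.contDiff_normed
  rw [(ρ.hasCompactSupport_normed.hasFDerivAt_convolution_left (lsmul ℝ ℝ) hρ hg x).fderiv]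
  change (fderiv ℝ (ρ.normed μ) ⋆[((lsmul ℝ ℝ).flip.precompR E).flip, μ] g) x v = _
  rw [convolution_flip, convolution_precompR_apply _ hg (ρ.hasCompactSupport_normed.fderiv ℝ)
    (hρ.continuous_fderiv one_ne_zero), convolution_def]
  simp

end Mollification

/-! ### Chain rule for weak derivatives -/

section ChainRule

theorem setIntegral_mul_eq_integral_mul {α : Type*} [MeasurableSpace α] {μ : Measure α}
    {K S : Set α} (hKS : K ⊆ S) {a b ψ : α → ℝ} (hψ : ∀ x, x ∉ K → ψ x = 0)
    (hab : ∀ x ∈ K, a x = b x) : ∫ x in S, a x * ψ x ∂μ = ∫ x, b x * ψ x ∂μ := by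
  rw [setIntegral_eq_integral_of_forall_compl_eq_zero
    (fun x hx => by rw [hψ x fun h => hx (hKS h), mul_zero])]
  refine integral_congr_ae (ae_of_all _ fun x => ?_)
  by_cases hx : x ∈ K
  · simp only [hab x hx]
  · simp only [hψ x hx, mul_zero]

theorem fderiv_apply_eq_zero_of_notMem_tsupport {E : Type*} [NormedAddCommGroup E]
    [NormedSpace ℝ E] {φ : E → ℝ} {x : E} (hx : x ∉ tsupport φ) (v : E) :
    fderiv ℝ φ x v = 0 := by
  have h : x ∉ Function.support (fderiv ℝ φ) := fun h => hx (support_fderiv_subset ℝ h)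
  rw [Function.notMem_support.1 h, zero_apply]

variable {N : ℕ} {Ω : Opens (RN N)} {i : Fin N} {u g : RN N → ℝ}

/-- Partial derivatives of a mollification, at a distance from the boundary. -/
theorem HasWeakPartialDeriv.fderiv_normed_convolution (h : HasWeakPartialDeriv Ω i u g)
    {K : Set (RN N)} (hK : K ⊆ Ω) (hKm : MeasurableSet K) (hu : IntegrableOn u K)
    (ρ : ContDiffBump (0 : RN N)) {x : RN N} (hx : Metric.closedBall x ρ.rOut ⊆ K) :
    fderiv ℝ (ρ.normed volume ⋆[lsmul ℝ ℝ, volume] K.indicator u) x (EuclideanSpace.single i 1) =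
      (ρ.normed volume ⋆[lsmul ℝ ℝ, volume] K.indicator g) x := by
  have hρ : ContDiff ℝ ((⊤ : ℕ∞) : WithTop ℕ∞) (ρ.normed (volume : Measure (RN N))) :=
    ρ.contDiff_normed
  have hsupp : tsupport (fun t => ρ.normed (volume : Measure (RN N)) (x - t)) ⊆
      Metric.closedBall x ρ.rOut := by
    refine closure_minimal (fun t ht => ?_) Metric.isClosed_closedBall
    have h1 : x - t ∈ Function.support (ρ.normed (volume : Measure (RN N))) := ht
    rw [ρ.support_normed_eq, mem_ball_zero_iff] at h1
    rw [Metric.mem_closedBall, dist_comm, dist_eq_norm]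
    exact h1.le
  -- The reflected bump is a legitimate test function because the ball around `x` lies in `Ω`; the
  -- sign from the reflection cancels the one in the weak derivative.
  let η : 𝓓(Ω, ℝ) := ⟨fun t => ρ.normed volume (x - t), hρ.comp (contDiff_const.sub contDiff_id),
    (isCompact_closedBall x ρ.rOut).of_isClosed_subset (isClosed_tsupport _) hsupp,
    hsupp.trans (hx.trans hK)⟩
  have hη : ∀ t, fderiv ℝ η t (EuclideanSpace.single i 1) =
      - fderiv ℝ (ρ.normed volume) (x - t) (EuclideanSpace.single i 1) := by
    intro t
    have hd : HasFDerivAt (fun t => ρ.normed (volume : Measure (RN N)) (x - t))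
        ((fderiv ℝ (ρ.normed volume) (x - t)).comp (-ContinuousLinearMap.id ℝ (RN N))) t :=
      ((hρ.differentiable (by simp)).differentiableAt.hasFDerivAt (x := x - t)).comp t
        ((hasFDerivAt_id t).const_sub x)
    change fderiv ℝ (fun t => ρ.normed (volume : Measure (RN N)) (x - t)) t _ = _
    rw [hd.fderiv]
    simp
  have hη0 : ∀ t, t ∉ K → fderiv ℝ η t (EuclideanSpace.single i 1) = 0 := fun t ht =>
    fderiv_apply_eq_zero_of_notMem_tsupport (fun h' => ht (hx (hsupp h'))) _
  have hη1 : ∀ t, t ∉ K → η t = 0 := fun t ht =>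
    image_eq_zero_of_notMem_tsupport (fun h' => ht (hx (hsupp h')))
  have h1 := h η
  rw [setIntegral_mul_eq_integral_mul (K := K) (b := K.indicator u) hK
      hη0
      (fun t ht => (Set.indicator_of_mem ht u).symm),
    setIntegral_mul_eq_integral_mul (K := K) (b := K.indicator g) hK
      hη1
      (fun t ht => (Set.indicator_of_mem ht g).symm)] at h1
  rw [fderiv_normed_convolution_apply ρ
    ((integrable_indicator_iff hKm).2 hu).locallyIntegrable, convolution_eq_swap]
  simp only [hη, mul_neg, integral_neg, neg_inj] at h1
  simp only [lsmul_apply, smul_eq_mul]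
  simp_rw [mul_comm (fderiv ℝ _ _ _), h1]
  exact integral_congr_ae (ae_of_all _ fun t => mul_comm _ _)

/-- The chain rule for weak derivatives and `C¹` functions with derivative bounded by `1`. -/
theorem HasWeakPartialDeriv.comp (h : HasWeakPartialDeriv Ω i u g)
    (hu : LocallyIntegrableOn u Ω) (hg : LocallyIntegrableOn g Ω) {F f : ℝ → ℝ}
    (hF : ∀ t, HasDerivAt F (f t) t) (hf : Continuous f) (hb : ∀ t, |f t| ≤ 1) (hF0 : F 0 = 0) :
    HasWeakPartialDeriv Ω i (fun x => F (u x)) (fun x => f (u x) * g x) := by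
  intro φ
  set e : RN N := EuclideanSpace.single i 1
  have hφK : IsCompact (tsupport φ) := φ.hasCompactSupport
  -- Mollifying with radius at most `r` at points of `tsupport φ` only sees the compact set `K`
  -- inside `Ω`, on which `u` and `g` are integrable.
  obtain ⟨r, hr, hrΩ⟩ := hφK.exists_cthickening_subset_open Ω.isOpen φ.tsupport_subset
  set K := Metric.cthickening r (tsupport φ)
  have hKc : IsCompact K := hφK.cthickening
  have hφ_sub : tsupport φ ⊆ K := Metric.self_subset_cthickening _
  have huK : Integrable (K.indicator u) :=
    (integrable_indicator_iff hKc.measurableSet).2 (hu.integrableOn_compact_subset hrΩ hKc)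
  have hgK : Integrable (K.indicator g) :=
    (integrable_indicator_iff hKc.measurableSet).2 (hg.integrableOn_compact_subset hrΩ hKc)
  have hFlip : ∀ s t, |F s - F t| ≤ |s - t| := by
    intro s t
    have := Convex.norm_image_sub_le_of_norm_hasDerivWithin_le (s := Set.univ) (x := t) (y := s)
      (fun x _ => (hF x).hasDerivWithinAt) (fun x _ => hb x) convex_univ trivial trivial
    simpa using this
  have hFc : Continuous F := continuous_iff_continuousAt.2 fun t => (hF t).continuousAt
  have hF1 : ContDiff ℝ 1 F := by
    rw [contDiff_one_iff_deriv]
    refine ⟨fun t => (hF t).differentiableAt, ?_⟩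
    rwa [show deriv F = f from funext fun t => (hF t).deriv]
  -- The inner radius is a fixed fraction of the outer one, as almost everywhere convergence of
  -- mollifications requires.
  let ρ : ℕ → ContDiffBump (0 : RN N) := fun n =>
    ⟨r / (n + 1) / 2, r / (n + 1), by positivity, half_lt_self (by positivity)⟩
  have hρle : ∀ n, (ρ n).rOut ≤ r := fun n =>
    div_le_self hr.le (by linarith [(Nat.cast_nonneg n : (0 : ℝ) ≤ n)])
  have hρ0 : Tendsto (fun n => (ρ n).rOut) atTop (𝓝 0) := by
    have := (tendsto_one_div_add_atTop_nhds_zero_nat (𝕜 := ℝ)).const_mul r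
    simpa [ρ, div_eq_mul_inv] using this
  have hρK : ∀ n, (ρ n).rOut ≤ 2 * (ρ n).rIn := fun n => by
    change r / (n + 1) ≤ 2 * (r / (n + 1) / 2)
    linarith
  set U : ℕ → RN N → ℝ := fun n => (ρ n).normed volume ⋆[lsmul ℝ ℝ, volume] K.indicator u
  set G : ℕ → RN N → ℝ := fun n => (ρ n).normed volume ⋆[lsmul ℝ ℝ, volume] K.indicator g
  have hU1 : ∀ n, ContDiff ℝ 1 (U n) := fun n =>
    (ρ n).hasCompactSupport_normed.contDiff_convolution_left _ (ρ n).contDiff_normed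
      huK.locallyIntegrable
  have hUint : ∀ n, Integrable (U n) := fun n => integrable_normed_convolution (ρ n) huK
  have hGint : ∀ n, Integrable (G n) := fun n => integrable_normed_convolution (ρ n) hgK
  have hUG : ∀ n, ∀ x ∈ tsupport φ, fderiv ℝ (U n) x e = G n x := fun n x hx =>
    h.fderiv_normed_convolution hrΩ hKc.measurableSet
      (hu.integrableOn_compact_subset hrΩ hKc) (ρ n)
      ((Metric.closedBall_subset_closedBall (hρle n)).trans
        (Metric.closedBall_subset_cthickening hx r))
  have hφ1 : ContDiff ℝ 1 φ := φ.contDiff.of_le (by exact_mod_cast le_top)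
  have hdφc : Continuous fun x => fderiv ℝ φ x e :=
    (hφ1.continuous_fderiv one_ne_zero).clm_apply continuous_const
  have hdφs : HasCompactSupport fun x => fderiv ℝ φ x e :=
    φ.hasCompactSupport.fderiv_apply ℝ e
  obtain ⟨C, hC⟩ := φ.continuous.bounded_above_of_compact_support φ.hasCompactSupport
  obtain ⟨D, hD⟩ := hdφc.bounded_above_of_compact_support hdφs
  -- Classical integration by parts. The derivative of `U n` is known to be `G n` only on `tsupport
  -- φ`, but `φ` vanishes elsewhere.
  have hibp : ∀ n, ∫ x, F (U n x) * fderiv ℝ φ x e = - ∫ x, f (U n x) * G n x * φ x := by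
    intro n
    have hFU : ContDiff ℝ 1 fun x => F (U n x) := hF1.comp (hU1 n)
    have hd : ∀ x, fderiv ℝ (fun x => F (U n x)) x e = f (U n x) * fderiv ℝ (U n) x e := by
      intro x
      have := (hF (U n x)).comp_hasFDerivAt x
        ((hU1 n).differentiable one_ne_zero).differentiableAt.hasFDerivAt
      rw [show (fun x => F (U n x)) = F ∘ U n from rfl, this.fderiv]
      simp
    rw [integral_mul_fderiv_eq_neg_fderiv_mul_of_integrable]
    · congr 1
      refine integral_congr_ae (ae_of_all _ fun x => ?_)
      by_cases hx : x ∈ tsupport φ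
      · simp only [hd, hUG n x hx]
      · simp only [image_eq_zero_of_notMem_tsupport hx, mul_zero]
    · exact (((hFU.continuous_fderiv one_ne_zero).clm_apply continuous_const).mul
        φ.continuous).integrable_of_hasCompactSupport φ.hasCompactSupport.mul_left
    · exact (hFU.continuous.mul hdφc).integrable_of_hasCompactSupport hdφs.mul_left
    · exact (hFU.continuous.mul φ.continuous).integrable_of_hasCompactSupport
        φ.hasCompactSupport.mul_left
    · exact fun x _ => (hFU.differentiable one_ne_zero).differentiableAt
    · exact fun x _ => (hφ1.differentiable one_ne_zero).differentiableAt
  have hUlim : Tendsto (fun n => ∫ x, |U n x - K.indicator u x|) atTop (𝓝 0) :=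
    tendsto_integral_abs_normed_convolution_sub hρ0 hρK huK
  have hGlim : Tendsto (fun n => ∫ x, |G n x - K.indicator g x|) atTop (𝓝 0) :=
    tendsto_integral_abs_normed_convolution_sub hρ0 hρK hgK
  have hUae : ∀ᵐ x, Tendsto (fun n => U n x) atTop (𝓝 (K.indicator u x)) :=
    ContDiffBump.ae_convolution_tendsto_right_of_locallyIntegrable hρ0
        (Eventually.of_forall hρK) huK.locallyIntegrable
  have hFint : ∀ w : RN N → ℝ, Integrable w → Integrable fun x => F (w x) * fderiv ℝ φ x e := by
    intro w hw
    refine Integrable.mul_bdd (c := D) ?_ hdφc.aestronglyMeasurable (ae_of_all _ hD)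
    refine hw.mono (hFc.comp_aestronglyMeasurable hw.1) (ae_of_all _ fun x => ?_)
    have := hFlip (w x) 0
    simpa [hF0] using this
  have hfint : ∀ w v : RN N → ℝ, Integrable w → Integrable v →
      Integrable fun x => f (w x) * v x * φ x := by
    intro w v hw hv
    refine Integrable.mul_bdd (c := C) ?_ φ.continuous.aestronglyMeasurable (ae_of_all _ hC)
    exact hv.bdd_mul (c := 1) (hf.comp_aestronglyMeasurable hw.1) (ae_of_all _ fun x => hb _)
  have hL : Tendsto (fun n => ∫ x, F (U n x) * fderiv ℝ φ x e) atTop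
      (𝓝 (∫ x, F (K.indicator u x) * fderiv ℝ φ x e)) := by
    rw [tendsto_iff_norm_sub_tendsto_zero]
    refine squeeze_zero (fun _ => norm_nonneg _) (fun n => ?_) (by simpa using hUlim.mul_const D)
    rw [← integral_sub (hFint _ (hUint n)) (hFint _ huK), ← integral_mul_const]
    refine norm_integral_le_of_norm_le (((hUint n).sub huK).abs.mul_const D)
      (ae_of_all _ fun x => ?_)
    rw [← sub_mul, norm_mul]
    exact mul_le_mul (hFlip _ _) (hD x) (norm_nonneg _) (abs_nonneg _)
  -- The right-hand side is split: the error in `G n` is handled by L¹ convergence and `|f| ≤ 1`,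
  -- the error in `f (U n x)` by dominated convergence, as `U n` converges almost everywhere.
  have hR1 : Tendsto (fun n => ∫ x, f (U n x) * (G n x - K.indicator g x) * φ x) atTop
      (𝓝 0) := by
    refine squeeze_zero_norm (fun n => ?_) (by simpa using hGlim.mul_const C)
    rw [← integral_mul_const]
    refine norm_integral_le_of_norm_le (((hGint n).sub hgK).abs.mul_const C)
      (ae_of_all _ fun x => ?_)
    rw [norm_mul, norm_mul]
    refine mul_le_mul ?_ (hC x) (norm_nonneg _) (abs_nonneg _)
    exact mul_le_of_le_one_left (norm_nonneg _) (hb _)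
  have hR2 : Tendsto (fun n => ∫ x, f (U n x) * K.indicator g x * φ x) atTop
      (𝓝 (∫ x, f (K.indicator u x) * K.indicator g x * φ x)) := by
    refine tendsto_integral_of_dominated_convergence (fun x => |K.indicator g x| * C)
      (fun n => (hfint _ _ (hUint n) hgK).1) (hgK.abs.mul_const C)
      (fun n => ae_of_all _ fun x => ?_) ?_
    · rw [norm_mul, norm_mul]
      refine mul_le_mul ?_ (hC x) (norm_nonneg _) (abs_nonneg _)
      exact mul_le_of_le_one_left (norm_nonneg _) (hb _)
    · filter_upwards [hUae] with x hx
      exact (((hf.tendsto _).comp hx).mul_const _).mul_const _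
  have hR : Tendsto (fun n => ∫ x, f (U n x) * G n x * φ x) atTop
      (𝓝 (∫ x, f (K.indicator u x) * K.indicator g x * φ x)) := by
    have := hR1.add hR2
    rw [zero_add] at this
    refine this.congr fun n => ?_
    refine (integral_add (hfint _ _ (hUint n) ((hGint n).sub hgK))
      (hfint _ _ (hUint n) hgK)).symm.trans (integral_congr_ae (ae_of_all _ fun x => ?_))
    simp only [Pi.sub_apply]
    ring
  have hfin := tendsto_nhds_unique (hL.congr hibp) hR.neg
  rw [setIntegral_mul_eq_integral_mul (K := tsupport φ) (b := fun x => F (K.indicator u x))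
      φ.tsupport_subset (fun x hx => fderiv_apply_eq_zero_of_notMem_tsupport hx _)
      (fun x hx => by rw [Set.indicator_of_mem (hφ_sub hx)]), hfin,
    setIntegral_mul_eq_integral_mul (K := tsupport φ)
      (b := fun x => f (K.indicator u x) * K.indicator g x)
      φ.tsupport_subset (fun x hx => image_eq_zero_of_notMem_tsupport hx)
      (fun x hx => by simp only [Set.indicator_of_mem (hφ_sub hx)])]

end ChainRule

/-! ### Weak derivative of the positive part; linearity and uniqueness -/

section PositivePart

/-- A continuous approximation of the indicator function of `(0, ∞)`. -/
noncomputable def ramp (n : ℕ) (t : ℝ) : ℝ := max 0 (min 1 (n * t))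

theorem continuous_ramp (n : ℕ) : Continuous (ramp n) := by
  unfold ramp; fun_prop

theorem abs_ramp_le_one (n : ℕ) (t : ℝ) : |ramp n t| ≤ 1 := by
  rw [abs_of_nonneg (le_max_left _ _)]
  exact max_le zero_le_one (min_le_left _ _)

theorem tendsto_ramp (t : ℝ) :
    Tendsto (fun n => ramp n t) atTop (𝓝 (if 0 < t then 1 else 0)) := by
  split_ifs with ht
  · obtain ⟨m, hm⟩ := exists_nat_ge (1 / t)
    refine tendsto_const_nhds.congr' ?_
    filter_upwards [eventually_ge_atTop m] with n hn
    have h1 : (1 : ℝ) ≤ n * t := by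
      rw [div_le_iff₀ ht] at hm
      exact hm.trans (by gcongr)
    rw [ramp, min_eq_left h1, max_eq_right zero_le_one]
  · refine tendsto_const_nhds.congr fun n => ?_
    have h1 : (n : ℝ) * t ≤ 0 := mul_nonpos_of_nonneg_of_nonpos (Nat.cast_nonneg n) (not_lt.1 ht)
    rw [ramp, max_eq_left ((min_le_right _ _).trans h1)]

/-- A continuously differentiable approximation of the positive part. -/
noncomputable def rampPrimitive (n : ℕ) (t : ℝ) : ℝ := ∫ s in (0 : ℝ)..t, ramp n s

theorem hasDerivAt_rampPrimitive (n : ℕ) (t : ℝ) :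
    HasDerivAt (rampPrimitive n) (ramp n t) t :=
  (continuous_ramp n).integral_hasStrictDerivAt 0 t |>.hasDerivAt

theorem abs_rampPrimitive_le (n : ℕ) (t : ℝ) : |rampPrimitive n t| ≤ |t| := by
  have := intervalIntegral.norm_integral_le_of_norm_le_const (a := 0) (b := t) (f := ramp n)
    (C := 1) fun s _ => abs_ramp_le_one n s
  simpa [rampPrimitive] using this

theorem tendsto_rampPrimitive (t : ℝ) :
    Tendsto (fun n => rampPrimitive n t) atTop (𝓝 (max t 0)) := by
  have h : ∫ s in (0 : ℝ)..t, (if 0 < s then (1 : ℝ) else 0) = max t 0 := by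
    rcases le_total 0 t with ht | ht
    · rw [intervalIntegral.integral_congr_ae (g := fun _ => (1 : ℝ)), max_eq_left ht]
      · simp
      · refine ae_of_all _ fun s hs => ?_
        rw [Set.uIoc_of_le ht] at hs
        exact if_pos hs.1
    · rw [intervalIntegral.integral_congr_ae (g := fun _ => (0 : ℝ)), max_eq_right ht]
      · simp
      · refine ae_of_all _ fun s hs => ?_
        rw [Set.uIoc_of_ge ht] at hs
        exact if_neg (not_lt.2 hs.2)
  rw [← h]
  refine intervalIntegral.tendsto_integral_filter_of_dominated_convergence (fun _ => 1)
    (Eventually.of_forall fun n => (continuous_ramp n).aestronglyMeasurable)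
    (Eventually.of_forall fun n => ae_of_all _ fun s _ => abs_ramp_le_one n s)
    intervalIntegrable_const (ae_of_all _ fun s _ => tendsto_ramp s)

variable {N : ℕ} {Ω : Opens (RN N)} {i : Fin N} {u v g : RN N → ℝ}

theorem integrableOn_mul_of_tsupport_subset (hv : LocallyIntegrableOn v Ω) {ψ : RN N → ℝ}
    (hψ : Continuous ψ) (hψc : HasCompactSupport ψ) (hψΩ : tsupport ψ ⊆ Ω) :
    IntegrableOn (fun x => v x * ψ x) Ω := by
  have hK : IsCompact (tsupport ψ) := hψc
  have h1 : IntegrableOn (fun x => v x * ψ x) (tsupport ψ) :=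
    (hv.integrableOn_compact_subset hψΩ hK).mul_continuousOn hψ.continuousOn hK
  refine ((integrableOn_iff_integrable_of_support_subset fun x hx => ?_).1 h1).integrableOn
  exact subset_tsupport ψ (right_ne_zero_of_mul hx)

theorem continuous_fderiv_testFunction (φ : 𝓓(Ω, ℝ)) (e : RN N) :
    Continuous fun x => fderiv ℝ φ x e :=
  (φ.contDiff.continuous_fderiv (by simp)).clm_apply continuous_const

theorem integrableOn_mul_testFunction (hv : LocallyIntegrableOn v Ω) (φ : 𝓓(Ω, ℝ)) :
    IntegrableOn (fun x => v x * φ x) Ω :=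
  integrableOn_mul_of_tsupport_subset hv φ.continuous φ.hasCompactSupport φ.tsupport_subset

theorem integrableOn_mul_fderiv_testFunction (hv : LocallyIntegrableOn v Ω) (φ : 𝓓(Ω, ℝ))
    (e : RN N) : IntegrableOn (fun x => v x * fderiv ℝ φ x e) Ω :=
  integrableOn_mul_of_tsupport_subset hv (continuous_fderiv_testFunction φ e)
    (φ.hasCompactSupport.fderiv_apply ℝ e)
    ((tsupport_fderiv_apply_subset ℝ e).trans φ.tsupport_subset)

/-- The chain rule applies to `rampPrimitive n`, whose derivative `ramp n` tends pointwise to the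
indicator of `(0, ∞)`. The bounds by `|u|` and `1` are uniform in `n`, so both sides of the identity
converge by domination. -/
theorem HasWeakPartialDeriv.posPart (h : HasWeakPartialDeriv Ω i u g)
    (hu : LocallyIntegrableOn u Ω) (hg : LocallyIntegrableOn g Ω) :
    HasWeakPartialDeriv Ω i (fun x => max (u x) 0) ({x | 0 < u x}.indicator g) := by
  intro φ
  have hum : AEStronglyMeasurable u (volume.restrict (Ω : Set (RN N))) := hu.aestronglyMeasurable
  have hgm : AEStronglyMeasurable g (volume.restrict (Ω : Set (RN N))) := hg.aestronglyMeasurable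
  have hn : ∀ n, ∫ x in (Ω : Set (RN N)), rampPrimitive n (u x) *
      fderiv ℝ φ x (EuclideanSpace.single i 1) =
      - ∫ x in (Ω : Set (RN N)), ramp n (u x) * g x * φ x := fun n =>
    h.comp hu hg (hasDerivAt_rampPrimitive n) (continuous_ramp n) (abs_ramp_le_one n)
      (by simp [rampPrimitive]) φ
  have hL : Tendsto (fun n => ∫ x in (Ω : Set (RN N)), rampPrimitive n (u x) *
      fderiv ℝ φ x (EuclideanSpace.single i 1)) atTop
      (𝓝 (∫ x in (Ω : Set (RN N)), max (u x) 0 * fderiv ℝ φ x (EuclideanSpace.single i 1))) := by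
    refine tendsto_integral_of_dominated_convergence
      (fun x => ‖u x * fderiv ℝ φ x (EuclideanSpace.single i 1)‖) (fun n => ?_)
      (integrableOn_mul_fderiv_testFunction hu φ _).norm (fun n => ae_of_all _ fun x => ?_)
      (ae_of_all _ fun x => (tendsto_rampPrimitive (u x)).mul_const _)
    · have hc : Continuous (rampPrimitive n) :=
        continuous_iff_continuousAt.2 fun t => (hasDerivAt_rampPrimitive n t).continuousAt
      exact (hc.comp_aestronglyMeasurable hum).mul
        (continuous_fderiv_testFunction φ _).aestronglyMeasurable
    · rw [norm_mul, norm_mul]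
      exact mul_le_mul_of_nonneg_right (abs_rampPrimitive_le n _) (norm_nonneg _)
  have hR : Tendsto (fun n => ∫ x in (Ω : Set (RN N)), ramp n (u x) * g x * φ x) atTop
      (𝓝 (∫ x in (Ω : Set (RN N)), {x | 0 < u x}.indicator g x * φ x)) := by
    refine tendsto_integral_of_dominated_convergence (fun x => ‖g x * φ x‖) (fun n => ?_)
      (integrableOn_mul_testFunction hg φ).norm (fun n => ae_of_all _ fun x => ?_)
      (ae_of_all _ fun x => ?_)
    · exact (((continuous_ramp n).comp_aestronglyMeasurable hum).mul hgm).mul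
        φ.continuous.aestronglyMeasurable
    · rw [norm_mul, norm_mul, norm_mul]
      refine mul_le_mul_of_nonneg_right ?_ (norm_nonneg _)
      exact mul_le_of_le_one_left (norm_nonneg _) (abs_ramp_le_one n _)
    · have hind : {x | 0 < u x}.indicator g x = (if 0 < u x then 1 else 0) * g x := by
        simp [Set.indicator_apply]
      rw [hind]
      exact ((tendsto_ramp (u x)).mul_const _).mul_const _
  exact tendsto_nhds_unique (hL.congr hn) hR.neg

theorem HasWeakPartialDeriv.add {u' g' : RN N → ℝ} (h : HasWeakPartialDeriv Ω i u g)
    (h' : HasWeakPartialDeriv Ω i u' g') (hu : LocallyIntegrableOn u Ω)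
    (hu' : LocallyIntegrableOn u' Ω) (hg : LocallyIntegrableOn g Ω)
    (hg' : LocallyIntegrableOn g' Ω) : HasWeakPartialDeriv Ω i (u + u') (g + g') := by
  intro φ
  simp only [Pi.add_apply, add_mul]
  rw [integral_add (integrableOn_mul_fderiv_testFunction hu φ _)
    (integrableOn_mul_fderiv_testFunction hu' φ _),
    integral_add (integrableOn_mul_testFunction hg φ) (integrableOn_mul_testFunction hg' φ),
    h φ, h' φ]
  ring

theorem HasWeakPartialDeriv.neg (h : HasWeakPartialDeriv Ω i u g) :
    HasWeakPartialDeriv Ω i (-u) (-g) := by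
  intro φ
  simp only [Pi.neg_apply, neg_mul, integral_neg, h φ]

/-- This is the fundamental lemma of the calculus of variations. -/
theorem HasWeakPartialDeriv.ae_eq {g' : RN N → ℝ} (h : HasWeakPartialDeriv Ω i u g)
    (h' : HasWeakPartialDeriv Ω i u g') (hg : LocallyIntegrableOn g Ω)
    (hg' : LocallyIntegrableOn g' Ω) : g =ᵐ[volume.restrict (Ω : Set (RN N))] g' := by
  have h0 := Ω.isOpen.ae_eq_zero_of_integral_contDiff_smul_eq_zero (hg.sub hg') (μ := volume)
    fun φ hφ hφc hφΩ => ?_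
  · rw [EventuallyEq, ae_restrict_iff' Ω.isOpen.measurableSet]
    filter_upwards [h0] with x hx hxΩ
    exact sub_eq_zero.1 (hx hxΩ)
  · let ψ : 𝓓(Ω, ℝ) := ⟨φ, hφ, hφc, hφΩ⟩
    have h1 : ∫ x in (Ω : Set (RN N)), g x * φ x = ∫ x in (Ω : Set (RN N)), g' x * φ x :=
      neg_injective ((h ψ).symm.trans (h' ψ))
    rw [← setIntegral_eq_integral_of_forall_compl_eq_zero (s := (Ω : Set (RN N)))
      (fun x hx => by
        rw [image_eq_zero_of_notMem_tsupport fun h => hx (hφΩ h), zero_smul])]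
    have h2 : ∀ x, φ x • (g - g') x = g x * φ x - g' x * φ x := fun x => by
      simp only [Pi.sub_apply, smul_eq_mul]; ring
    simp_rw [h2]
    exact (integral_sub (integrableOn_mul_testFunction hg ψ)
      (integrableOn_mul_testFunction hg' ψ)).trans (sub_eq_zero.2 h1)

end PositivePart

/-! ### Dominated convergence and weak derivatives in L^p -/

section Lp

theorem eLpNorm_rpow_eq_lintegral {α : Type*} [MeasurableSpace α] {μ : Measure α} {p : ℝ}
    (hp : 0 < p) (f : α → ℝ) : eLpNorm f (ENNReal.ofReal p) μ ^ p = ∫⁻ x, ‖f x‖ₑ ^ p ∂μ := by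
  rw [eLpNorm_eq_lintegral_rpow_enorm_toReal (by simpa using hp) ENNReal.ofReal_ne_top,
    ENNReal.toReal_ofReal hp.le, ← ENNReal.rpow_mul, one_div_mul_cancel hp.ne', ENNReal.rpow_one]

/-- Dominated convergence in `L^p`. -/
theorem tendsto_eLpNorm_sub_of_dominated {α : Type*} [MeasurableSpace α] {μ : Measure α} {p : ℝ}
    (hp : 0 < p) {F : ℕ → α → ℝ} {f : α → ℝ} {B : α → ℝ≥0∞}
    (hF : ∀ n, AEStronglyMeasurable (F n) μ) (hB : ∫⁻ x, B x ∂μ ≠ ∞)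
    (hbd : ∀ n, ∀ᵐ x ∂μ, ‖F n x‖ₑ ^ p ≤ B x)
    (hlim : ∀ᵐ x ∂μ, Tendsto (fun n => F n x) atTop (𝓝 (f x))) :
    MemLp f (ENNReal.ofReal p) μ ∧
      eLpNorm f (ENNReal.ofReal p) μ ^ p ≤ ∫⁻ x, B x ∂μ ∧
      Tendsto (fun n => eLpNorm (F n - f) (ENNReal.ofReal p) μ) atTop (𝓝 0) := by
  have hfm : AEStronglyMeasurable f μ := aestronglyMeasurable_of_tendsto_ae atTop hF hlim
  have hbd' : ∀ᵐ x ∂μ, ∀ n, ‖F n x‖ₑ ^ p ≤ B x := ae_all_iff.2 hbd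
  have hfB : ∀ᵐ x ∂μ, ‖f x‖ₑ ^ p ≤ B x := by
    filter_upwards [hbd', hlim] with x hx hl
    exact le_of_tendsto ((ENNReal.continuous_rpow_const.tendsto _).comp hl.enorm)
      (Eventually.of_forall hx)
  have hfle : eLpNorm f (ENNReal.ofReal p) μ ^ p ≤ ∫⁻ x, B x ∂μ := by
    rw [eLpNorm_rpow_eq_lintegral hp]
    exact lintegral_mono_ae hfB
  refine ⟨⟨hfm, ?_⟩, hfle, ?_⟩
  · by_contra h
    rw [not_lt, top_le_iff] at h
    rw [h, ENNReal.top_rpow_of_pos hp, top_le_iff] at hfle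
    exact hB hfle
  · have hpow : Tendsto (fun n => ∫⁻ x, ‖(F n - f) x‖ₑ ^ p ∂μ) atTop
        (𝓝 (∫⁻ _, (0 : ℝ≥0∞) ∂μ)) := by
      -- Both `F n` and `f` are bounded by `B ^ (1 / p)`, so the `p`-th power of their difference is
      -- at most `2 ^ p * B`.
      refine tendsto_lintegral_of_dominated_convergence' (fun x => 2 ^ p * B x)
        (fun n => ((hF n).sub hfm).enorm.pow_const p) (fun n => ?_) ?_ ?_
      · filter_upwards [hbd n, hfB] with x h1 h2
        have h3 : ∀ {a : ℝ≥0∞}, a ^ p ≤ B x → a ≤ B x ^ (1 / p) := fun {a} ha => by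
          rwa [one_div, ENNReal.le_rpow_inv_iff hp]
        calc ‖(F n - f) x‖ₑ ^ p ≤ (‖F n x‖ₑ + ‖f x‖ₑ) ^ p :=
              ENNReal.rpow_le_rpow enorm_sub_le hp.le
          _ ≤ (2 * B x ^ (1 / p)) ^ p := by
              rw [two_mul]
              exact ENNReal.rpow_le_rpow (add_le_add (h3 h1) (h3 h2)) hp.le
          _ = 2 ^ p * B x := by
              rw [ENNReal.mul_rpow_of_nonneg _ _ hp.le, ← ENNReal.rpow_mul,
                one_div_mul_cancel hp.ne', ENNReal.rpow_one]
      · have h2 : (2 : ℝ≥0∞) ^ p ≠ ∞ := ENNReal.rpow_ne_top_of_nonneg hp.le (by simp)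
        rw [lintegral_const_mul' _ _ h2]
        exact ENNReal.mul_ne_top h2 hB
      · filter_upwards [hlim] with x hx
        have h1 : Tendsto (fun n => ‖(F n - f) x‖ₑ) atTop (𝓝 0) := by
          have := (hx.sub_const (f x)).enorm
          simpa using this
        have := (ENNReal.continuous_rpow_const (y := p)).tendsto 0 |>.comp h1
        simpa [ENNReal.zero_rpow_of_pos hp, Function.comp_def] using this
    simp only [lintegral_zero] at hpow
    have := (ENNReal.continuous_rpow_const (y := 1 / p)).tendsto 0 |>.comp hpow
    rw [ENNReal.zero_rpow_of_pos (by positivity)] at this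
    refine this.congr fun n => ?_
    rw [Function.comp_apply, ← eLpNorm_rpow_eq_lintegral hp, ← ENNReal.rpow_mul,
      mul_one_div_cancel hp.ne', ENNReal.rpow_one]

variable {N : ℕ} {Ω : Opens (RN N)} {p : ℝ}

theorem MemLpOn.locallyIntegrableOn (hp : 1 ≤ p) {v : RN N → ℝ} (hv : MemLpOn Ω p v) :
    LocallyIntegrableOn v Ω :=
  locallyIntegrableOn_of_locallyIntegrable_restrict
    (MemLp.locallyIntegrable hv (by simpa using hp))

theorem tendsto_setIntegral_mul_of_tendsto_eLpNorm (hp : 1 ≤ p) {v : ℕ → RN N → ℝ} {w : RN N → ℝ}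
    (hv : ∀ n, MemLpOn Ω p (v n)) (hw : MemLpOn Ω p w)
    (h : Tendsto (fun n => eLpNorm (v n - w) (ENNReal.ofReal p)
      (volume.restrict (Ω : Set (RN N)))) atTop (𝓝 0))
    {ψ : RN N → ℝ} (hψ : Continuous ψ) (hψc : HasCompactSupport ψ) :
    Tendsto (fun n => ∫ x in (Ω : Set (RN N)), v n x * ψ x) atTop
      (𝓝 (∫ x in (Ω : Set (RN N)), w x * ψ x)) := by
  have hP : 1 ≤ ENNReal.ofReal p := by simpa using hp
  have := ENNReal.HolderConjugate.conjExponent hP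
  have hψq : MemLp ψ (ENNReal.ofReal p).conjExponent (volume.restrict (Ω : Set (RN N))) :=
    hψ.memLp_of_hasCompactSupport hψc
  have hint : ∀ w, MemLpOn Ω p w → IntegrableOn (fun x => w x * ψ x) Ω := fun w hw =>
    MemLp.integrable_mul hw hψq
  refine tendsto_integral_of_L1' _ (hint w hw).1 (Eventually.of_forall fun n => hint _ (hv n)) ?_
  have h1 : Tendsto (fun n => eLpNorm (v n - w) (ENNReal.ofReal p)
      (volume.restrict (Ω : Set (RN N))) * eLpNorm ψ (ENNReal.ofReal p).conjExponent
      (volume.restrict (Ω : Set (RN N)))) atTop (𝓝 0) := by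
    have := ENNReal.Tendsto.mul_const (b := eLpNorm ψ (ENNReal.ofReal p).conjExponent
      (volume.restrict (Ω : Set (RN N)))) h (Or.inr hψq.2.ne)
    simpa using this
  refine tendsto_of_tendsto_of_tendsto_of_le_of_le tendsto_const_nhds h1 (fun _ => zero_le)
    fun n => ?_
  have := eLpNorm_smul_le_mul_eLpNorm (r := 1) (p := ENNReal.ofReal p)
    (q := (ENNReal.ofReal p).conjExponent) (f := ψ) (φ := v n - w)
    hψq.1 ((hv n).sub hw).1
  refine le_trans (le_of_eq ?_) this
  congr 1
  funext x
  simp [sub_mul]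

/-- By Hölder, integration against a fixed test function is continuous in `L^p`, so the defining
identity survives the limit. -/
theorem HasWeakPartialDeriv.of_tendsto (hp : 1 ≤ p) {i : Fin N} {v H : ℕ → RN N → ℝ}
    {u g : RN N → ℝ} (hvH : ∀ n, HasWeakPartialDeriv Ω i (v n) (H n))
    (hv : ∀ n, MemLpOn Ω p (v n)) (hH : ∀ n, MemLpOn Ω p (H n)) (hu : MemLpOn Ω p u)
    (hg : MemLpOn Ω p g)
    (hvu : Tendsto (fun n => eLpNorm (v n - u) (ENNReal.ofReal p)
      (volume.restrict (Ω : Set (RN N)))) atTop (𝓝 0))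
    (hHg : Tendsto (fun n => eLpNorm (H n - g) (ENNReal.ofReal p)
      (volume.restrict (Ω : Set (RN N)))) atTop (𝓝 0)) :
    HasWeakPartialDeriv Ω i u g := by
  intro φ
  have h1 := tendsto_setIntegral_mul_of_tendsto_eLpNorm hp hv hu hvu
    (continuous_fderiv_testFunction φ (EuclideanSpace.single i 1))
    (φ.hasCompactSupport.fderiv_apply ℝ _)
  have h2 := tendsto_setIntegral_mul_of_tendsto_eLpNorm hp hH hg hHg φ.continuous
    φ.hasCompactSupport
  exact tendsto_nhds_unique (h1.congr fun n => hvH n φ) h2.neg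

end Lp

/-! ### Calculus of Sobolev functions with an explicit gradient -/

section SobolevGradient

variable {N : ℕ} {Ω : Opens (RN N)} {p : ℝ}

/-- `u ∈ W^{1,p}(Ω)`, with weak gradient represented by `G`. -/
structure HasSobolevGrad (Ω : Opens (RN N)) (p : ℝ) (u : RN N → ℝ) (G : Fin N → RN N → ℝ) :
    Prop where
  memLp : MemLpOn Ω p u
  memLp_grad : ∀ i, MemLpOn Ω p (G i)
  hasWeakPartialDeriv : ∀ i, HasWeakPartialDeriv Ω i u (G i)

/-- Convergence in `L^p(Ω)`. -/
def TendstoLp (Ω : Opens (RN N)) (p : ℝ) (v : ℕ → RN N → ℝ) (w : RN N → ℝ) : Prop :=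
  Tendsto (fun n => eLpNorm (v n - w) (ENNReal.ofReal p) (volume.restrict (Ω : Set (RN N))))
    atTop (𝓝 0)

theorem mem_sobolevSpace_iff {u : RN N → ℝ} :
    u ∈ sobolevSpace Ω p ↔ ∃ G, HasSobolevGrad Ω p u G := by
  constructor
  · rintro ⟨hu, h⟩
    choose G hG hG' using h
    exact ⟨G, hu, hG, hG'⟩
  · rintro ⟨G, hu, hG, hG'⟩
    exact ⟨hu, fun i => ⟨G i, hG i, hG' i⟩⟩

namespace HasSobolevGrad

variable {u v : RN N → ℝ} {G H : Fin N → RN N → ℝ}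

theorem mem_sobolevSpace (h : HasSobolevGrad Ω p u G) : u ∈ sobolevSpace Ω p :=
  mem_sobolevSpace_iff.2 ⟨G, h⟩

theorem ae_eq (hp : 1 ≤ p) (h : HasSobolevGrad Ω p u G) (h' : HasSobolevGrad Ω p u H)
    (i : Fin N) : G i =ᵐ[volume.restrict (Ω : Set (RN N))] H i :=
  (h.hasWeakPartialDeriv i).ae_eq (h'.hasWeakPartialDeriv i)
    ((h.memLp_grad i).locallyIntegrableOn hp) ((h'.memLp_grad i).locallyIntegrableOn hp)

/-- Uniqueness of weak derivatives makes the choice in `weakPartialDeriv` harmless: any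
representative computes the norm. -/
theorem sobolevNormPow_eq (hp : 1 ≤ p) (h : HasSobolevGrad Ω p u G) :
    sobolevNormPow Ω p u =
      eLpNorm u (ENNReal.ofReal p) (volume.restrict (Ω : Set (RN N))) ^ p +
        ∑ i, eLpNorm (G i) (ENNReal.ofReal p) (volume.restrict (Ω : Set (RN N))) ^ p := by
  unfold sobolevNormPow
  congr 1
  refine Finset.sum_congr rfl fun i _ => ?_
  have hex : ∃ g, MemLpOn Ω p g ∧ HasWeakPartialDeriv Ω i u g :=
    ⟨G i, h.memLp_grad i, h.hasWeakPartialDeriv i⟩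
  rw [weakPartialDeriv, dif_pos hex]
  obtain ⟨h1, h2⟩ := hex.choose_spec
  rw [eLpNorm_congr_ae (h2.ae_eq (h.hasWeakPartialDeriv i) (h1.locallyIntegrableOn hp)
    ((h.memLp_grad i).locallyIntegrableOn hp))]

theorem add (hp : 1 ≤ p) (hu : HasSobolevGrad Ω p u G) (hv : HasSobolevGrad Ω p v H) :
    HasSobolevGrad Ω p (u + v) (fun i => G i + H i) where
  memLp := MemLp.add hu.memLp hv.memLp
  memLp_grad i := MemLp.add (hu.memLp_grad i) (hv.memLp_grad i)
  hasWeakPartialDeriv i := (hu.hasWeakPartialDeriv i).add (hv.hasWeakPartialDeriv i)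
    (hu.memLp.locallyIntegrableOn hp) (hv.memLp.locallyIntegrableOn hp)
    ((hu.memLp_grad i).locallyIntegrableOn hp) ((hv.memLp_grad i).locallyIntegrableOn hp)

theorem neg (hu : HasSobolevGrad Ω p u G) : HasSobolevGrad Ω p (-u) (fun i => -G i) where
  memLp := MemLp.neg hu.memLp
  memLp_grad i := MemLp.neg (hu.memLp_grad i)
  hasWeakPartialDeriv i := (hu.hasWeakPartialDeriv i).neg

theorem sub (hp : 1 ≤ p) (hu : HasSobolevGrad Ω p u G) (hv : HasSobolevGrad Ω p v H) :
    HasSobolevGrad Ω p (u - v) (fun i => G i - H i) := by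
  simpa only [sub_eq_add_neg] using hu.add hp hv.neg

theorem nullMeasurableSet_pos (hu : MemLpOn Ω p u) :
    NullMeasurableSet {x | 0 < u x} (volume.restrict (Ω : Set (RN N))) :=
  nullMeasurableSet_lt aemeasurable_const hu.1.aemeasurable

theorem posPart (hp : 1 ≤ p) (hu : HasSobolevGrad Ω p u G) :
    HasSobolevGrad Ω p (fun x => max (u x) 0) (fun i => {x | 0 < u x}.indicator (G i)) where
  memLp := MemLp.pos_part hu.memLp
  memLp_grad i := (hu.memLp_grad i).mono
    ((hu.memLp_grad i).1.indicator₀ (nullMeasurableSet_pos hu.memLp))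
    (ae_of_all _ fun _ => norm_indicator_le_norm_self _ _)
  hasWeakPartialDeriv i := (hu.hasWeakPartialDeriv i).posPart (hu.memLp.locallyIntegrableOn hp)
    ((hu.memLp_grad i).locallyIntegrableOn hp)

/-- The weak gradient of `u` vanishes almost everywhere on `{u = 0}`. -/
theorem ae_grad_eq_zero (hp : 1 ≤ p) (hu : HasSobolevGrad Ω p u G) (i : Fin N) :
    ∀ᵐ x ∂volume.restrict (Ω : Set (RN N)), u x = 0 → G i x = 0 := by
  -- Writing `u = u⁺ - (-u)⁺` yields a second gradient of `u`, built from indicators of `{u > 0}`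
  -- and `{u < 0}`; it is zero where `u = 0`, and gradients are unique.
  have h1 := (hu.posPart hp).sub hp (hu.neg.posPart hp)
  have h2 : ((fun x => max (u x) 0) - fun x => max ((-u) x) 0) = u := by
    funext x
    rcases le_total (u x) 0 with h | h <;> simp [h]
  rw [h2] at h1
  filter_upwards [hu.ae_eq hp h1 i] with x hx h0
  rw [hx]
  simp [h0]

end HasSobolevGrad

theorem TendstoLp.add (hp : 1 ≤ p) {v v' : ℕ → RN N → ℝ} {w w' : RN N → ℝ}
    (h : TendstoLp Ω p v w) (h' : TendstoLp Ω p v' w')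
    (hv : ∀ n, MemLpOn Ω p (v n)) (hv' : ∀ n, MemLpOn Ω p (v' n))
    (hw : MemLpOn Ω p w) (hw' : MemLpOn Ω p w') :
    TendstoLp Ω p (fun n => v n + v' n) (w + w') := by
  have hP : 1 ≤ ENNReal.ofReal p := by simpa using hp
  have h0 := Tendsto.add h h'
  rw [add_zero] at h0
  refine tendsto_of_tendsto_of_tendsto_of_le_of_le tendsto_const_nhds h0 (fun _ => zero_le)
    fun n => ?_
  change eLpNorm (v n + v' n - (w + w')) _ _ ≤ _
  rw [add_sub_add_comm]
  exact eLpNorm_add_le ((hv n).1.sub hw.1) ((hv' n).1.sub hw'.1) hP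

theorem TendstoLp.comp {v : ℕ → RN N → ℝ} {w : RN N → ℝ} (h : TendstoLp Ω p v w) {ns : ℕ → ℕ}
    (hns : StrictMono ns) : TendstoLp Ω p (fun n => v (ns n)) w := by
  unfold TendstoLp at h
  exact h.comp hns.tendsto_atTop

theorem TendstoLp.of_le {v v' : ℕ → RN N → ℝ} {w w' : RN N → ℝ} (h : TendstoLp Ω p v w)
    (hle : ∀ n x, ‖v' n x - w' x‖ ≤ ‖v n x - w x‖) : TendstoLp Ω p v' w' :=
  tendsto_of_tendsto_of_tendsto_of_le_of_le tendsto_const_nhds h (fun _ => zero_le)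
    fun n => eLpNorm_mono (hle n)

theorem sobolevNormPow_sub_comm (hp : 1 ≤ p) {u v : RN N → ℝ} (hu : u ∈ sobolevSpace Ω p)
    (hv : v ∈ sobolevSpace Ω p) : sobolevNormPow Ω p (u - v) = sobolevNormPow Ω p (v - u) := by
  obtain ⟨G, hG⟩ := mem_sobolevSpace_iff.1 hu
  obtain ⟨H, hH⟩ := mem_sobolevSpace_iff.1 hv
  rw [(hG.sub hp hH).sobolevNormPow_eq hp, (hH.sub hp hG).sobolevNormPow_eq hp,
    eLpNorm_sub_comm]
  simp_rw [eLpNorm_sub_comm (G _)]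

/-- Convergence of the Sobolev norms is convergence in `L^p` of the functions and of their
gradients. -/
theorem tendsto_sobolevNormPow_sub_iff (hp : 1 ≤ p) {u : RN N → ℝ} {G : Fin N → RN N → ℝ}
    {v : ℕ → RN N → ℝ} {H : ℕ → Fin N → RN N → ℝ} (hu : HasSobolevGrad Ω p u G)
    (hv : ∀ n, HasSobolevGrad Ω p (v n) (H n)) :
    Tendsto (fun n => sobolevNormPow Ω p (v n - u)) atTop (𝓝 0) ↔
      TendstoLp Ω p v u ∧ ∀ i, TendstoLp Ω p (fun n => H n i) (G i) := by
  have hp0 : 0 < p := by linarith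
  have hroot : ∀ {a : ℕ → ℝ≥0∞},
      Tendsto (fun n => a n ^ p) atTop (𝓝 0) → Tendsto a atTop (𝓝 0) := by
    intro a ha
    have := (ENNReal.continuous_rpow_const (y := 1 / p)).tendsto 0 |>.comp ha
    rw [ENNReal.zero_rpow_of_pos (by positivity)] at this
    refine this.congr fun n => ?_
    rw [Function.comp_apply, ← ENNReal.rpow_mul, mul_one_div_cancel hp0.ne', ENNReal.rpow_one]
  have hpow : ∀ {a : ℕ → ℝ≥0∞},
      Tendsto a atTop (𝓝 0) → Tendsto (fun n => a n ^ p) atTop (𝓝 0) := by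
    intro a ha
    have := (ENNReal.continuous_rpow_const (y := p)).tendsto 0 |>.comp ha
    rwa [ENNReal.zero_rpow_of_pos hp0] at this
  simp_rw [fun n => ((hv n).sub hp hu).sobolevNormPow_eq hp]
  constructor
  · intro h
    refine ⟨hroot ?_, fun i => hroot ?_⟩
    · exact tendsto_of_tendsto_of_tendsto_of_le_of_le tendsto_const_nhds h (fun _ => zero_le)
        fun n => le_self_add
    · refine tendsto_of_tendsto_of_tendsto_of_le_of_le tendsto_const_nhds h (fun _ => zero_le)
        fun n => le_add_left ?_
      exact Finset.single_le_sum (f := fun i => eLpNorm (H n i - G i) (ENNReal.ofReal p)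
        (volume.restrict (Ω : Set (RN N))) ^ p) (fun _ _ => zero_le) (Finset.mem_univ i)
  · rintro ⟨h1, h2⟩
    have h3 := (hpow h1).add (tendsto_finsetSum Finset.univ fun i _ => hpow (h2 i))
    simpa using h3

end SobolevGradient

/-! ### Lattice operations on the closure of the continuous functions -/

section Tilde

variable {N : ℕ} {Ω : Opens (RN N)} {p : ℝ} {u v : RN N → ℝ} {G H : Fin N → RN N → ℝ}

theorem exists_seq_of_mem_sobolevTilde (hp : 1 ≤ p) (hu : u ∈ sobolevTilde Ω p)
    (hG : HasSobolevGrad Ω p u G) :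
    ∃ (v : ℕ → RN N → ℝ) (H : ℕ → Fin N → RN N → ℝ), (∀ n, v n ∈ sobolevCc Ω p) ∧
      (∀ n, HasSobolevGrad Ω p (v n) (H n)) ∧ TendstoLp Ω p v u ∧
      ∀ i, TendstoLp Ω p (fun n => H n i) (G i) := by
  have h : ∀ n : ℕ, ∃ v ∈ sobolevCc Ω p, sobolevNormPow Ω p (u - v) < ((n : ℝ≥0∞) + 1)⁻¹ :=
    fun n => hu.2 _ (by simp)
  choose v hv hlt using h
  choose H hH using fun n => mem_sobolevSpace_iff.1 (hv n).1
  refine ⟨v, H, hv, hH, (tendsto_sobolevNormPow_sub_iff hp hG hH).1 ?_⟩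
  have h0 : Tendsto (fun n : ℕ => ((n : ℝ≥0∞) + 1)⁻¹) atTop (𝓝 0) := by
    have := (tendsto_add_atTop_iff_nat 1).2 ENNReal.tendsto_inv_nat_nhds_zero
    simpa using this
  refine tendsto_of_tendsto_of_tendsto_of_le_of_le tendsto_const_nhds h0 (fun _ => zero_le)
    fun n => ?_
  rw [sobolevNormPow_sub_comm hp (hv n).1 hu.1]
  exact (hlt n).le

theorem mem_sobolevTilde_of_tendsto_sobolevCc (hp : 1 ≤ p) (hG : HasSobolevGrad Ω p u G)
    {v : ℕ → RN N → ℝ} {H : ℕ → Fin N → RN N → ℝ} (hv : ∀ n, v n ∈ sobolevCc Ω p)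
    (hH : ∀ n, HasSobolevGrad Ω p (v n) (H n)) (hvu : TendstoLp Ω p v u)
    (hHG : ∀ i, TendstoLp Ω p (fun n => H n i) (G i)) : u ∈ sobolevTilde Ω p := by
  refine ⟨hG.mem_sobolevSpace, fun ε hε => ?_⟩
  have h := (tendsto_sobolevNormPow_sub_iff hp hG hH).2 ⟨hvu, hHG⟩
  obtain ⟨n, hn⟩ := (h.eventually_lt_const hε).exists
  exact ⟨v n, hv n, by rwa [sobolevNormPow_sub_comm hp hG.mem_sobolevSpace (hv n).1]⟩

theorem mem_sobolevTilde_of_tendsto (hp : 1 ≤ p) (hG : HasSobolevGrad Ω p u G)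
    {v : ℕ → RN N → ℝ} {H : ℕ → Fin N → RN N → ℝ} (hv : ∀ n, v n ∈ sobolevTilde Ω p)
    (hH : ∀ n, HasSobolevGrad Ω p (v n) (H n)) (hvu : TendstoLp Ω p v u)
    (hHG : ∀ i, TendstoLp Ω p (fun n => H n i) (G i)) : u ∈ sobolevTilde Ω p := by
  have h : ∀ n : ℕ, ∃ w ∈ sobolevCc Ω p, sobolevNormPow Ω p (v n - w) < ((n : ℝ≥0∞) + 1)⁻¹ :=
    fun n => (hv n).2 _ (by simp)
  choose w hw hlt using h
  choose K hK using fun n => mem_sobolevSpace_iff.1 (hw n).1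
  have h0 : Tendsto (fun n : ℕ => ((n : ℝ≥0∞) + 1)⁻¹) atTop (𝓝 0) := by
    have := (tendsto_add_atTop_iff_nat 1).2 ENNReal.tendsto_inv_nat_nhds_zero
    simpa using this
  -- The norm criterion is applied to `w n - v n`, with limit `0`, to split its convergence into
  -- functions and gradients.
  have hzero : HasSobolevGrad Ω p (0 : RN N → ℝ) (fun _ => 0) :=
    ⟨MemLp.zero, fun _ => MemLp.zero, fun i φ => by simp⟩
  have hd := (tendsto_sobolevNormPow_sub_iff hp hzero
    (v := fun n => w n - v n) (fun n => (hK n).sub hp (hH n))).1 (by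
      refine tendsto_of_tendsto_of_tendsto_of_le_of_le tendsto_const_nhds h0 (fun _ => zero_le)
        fun n => ?_
      rw [sub_zero, sobolevNormPow_sub_comm hp (hw n).1 (hv n).1]
      exact (hlt n).le)
  refine mem_sobolevTilde_of_tendsto_sobolevCc hp hG hw hK ?_ fun i => ?_
  · have := hd.1.add hp hvu (fun n => ((hK n).sub hp (hH n)).memLp) (fun n => (hH n).memLp)
      MemLp.zero hG.memLp
    simpa using this
  · have := (hd.2 i).add hp (hHG i) (fun n => ((hK n).sub hp (hH n)).memLp_grad i)
      (fun n => (hH n).memLp_grad i) MemLp.zero (hG.memLp_grad i)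
    simpa using this

theorem sobolevCc_posPart (hp : 1 ≤ p) (hu : u ∈ sobolevCc Ω p) :
    (fun x => max (u x) 0) ∈ sobolevCc Ω p := by
  obtain ⟨hW, w, hw⟩ := hu
  obtain ⟨G, hG⟩ := mem_sobolevSpace_iff.1 hW
  refine ⟨(hG.posPart hp).mem_sobolevSpace, w ⊔ 0, fun x hx => ?_⟩
  change max (u x) 0 = max (w x) 0
  rw [hw x hx]

theorem sobolevCc_add (hp : 1 ≤ p) (hu : u ∈ sobolevCc Ω p) (hv : v ∈ sobolevCc Ω p) :
    u + v ∈ sobolevCc Ω p := by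
  obtain ⟨hu, w, hw⟩ := hu
  obtain ⟨hv, w', hw'⟩ := hv
  obtain ⟨G, hG⟩ := mem_sobolevSpace_iff.1 hu
  obtain ⟨H, hH⟩ := mem_sobolevSpace_iff.1 hv
  refine ⟨(hG.add hp hH).mem_sobolevSpace, w + w', fun x hx => ?_⟩
  rw [Pi.add_apply, hw x hx, hw' x hx]
  rfl

theorem sobolevCc_neg (hu : u ∈ sobolevCc Ω p) : -u ∈ sobolevCc Ω p := by
  obtain ⟨hu, w, hw⟩ := hu
  obtain ⟨G, hG⟩ := mem_sobolevSpace_iff.1 hu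
  refine ⟨hG.neg.mem_sobolevSpace, -w, fun x hx => ?_⟩
  rw [Pi.neg_apply, hw x hx]
  rfl

theorem sobolevTilde_add (hp : 1 ≤ p) (hu : u ∈ sobolevTilde Ω p) (hv : v ∈ sobolevTilde Ω p) :
    u + v ∈ sobolevTilde Ω p := by
  obtain ⟨G, hG⟩ := mem_sobolevSpace_iff.1 hu.1
  obtain ⟨H, hH⟩ := mem_sobolevSpace_iff.1 hv.1
  obtain ⟨a, A, ha, hA, hau, hAG⟩ := exists_seq_of_mem_sobolevTilde hp hu hG
  obtain ⟨b, B, hb, hB, hbv, hBH⟩ := exists_seq_of_mem_sobolevTilde hp hv hH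
  exact mem_sobolevTilde_of_tendsto_sobolevCc hp (hG.add hp hH)
    (fun n => sobolevCc_add hp (ha n) (hb n)) (fun n => (hA n).add hp (hB n))
    (hau.add hp hbv (fun n => (hA n).memLp) (fun n => (hB n).memLp) hG.memLp hH.memLp)
    fun i => (hAG i).add hp (hBH i) (fun n => (hA n).memLp_grad i) (fun n => (hB n).memLp_grad i)
      (hG.memLp_grad i) (hH.memLp_grad i)

theorem sobolevTilde_neg (hp : 1 ≤ p) (hu : u ∈ sobolevTilde Ω p) : -u ∈ sobolevTilde Ω p := by
  obtain ⟨G, hG⟩ := mem_sobolevSpace_iff.1 hu.1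
  obtain ⟨a, A, ha, hA, hau, hAG⟩ := exists_seq_of_mem_sobolevTilde hp hu hG
  refine mem_sobolevTilde_of_tendsto_sobolevCc hp hG.neg (fun n => sobolevCc_neg (ha n))
    (fun n => (hA n).neg) (hau.of_le fun n x => ?_) fun i => (hAG i).of_le fun n x => ?_
  all_goals
    simp only [Pi.neg_apply]
    rw [← neg_sub', norm_neg]

/-- Positive parts of approximants of `u` converge in `L^p` because `t ↦ t⁺` is 1-Lipschitz. For the
gradients, `1_{a>0} A - 1_{u>0} G` is split as `1_{a>0} (A - G) + (1_{a>0} - 1_{u>0}) G`, and the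
second term needs an almost everywhere convergent subsequence. -/
theorem sobolevTilde_posPart (hp : 1 ≤ p) (hu : u ∈ sobolevTilde Ω p) :
    (fun x => max (u x) 0) ∈ sobolevTilde Ω p := by
  have hp0 : 0 < p := by linarith
  obtain ⟨G, hG⟩ := mem_sobolevSpace_iff.1 hu.1
  obtain ⟨a, A, ha, hA, hau, hAG⟩ := exists_seq_of_mem_sobolevTilde hp hu hG
  obtain ⟨ns, hns, hae⟩ := (tendstoInMeasure_of_tendsto_eLpNorm (by simpa using hp0)
    (fun n => (hA n).memLp.1) hG.memLp.1 hau).exists_seq_tendsto_ae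
  refine mem_sobolevTilde_of_tendsto_sobolevCc hp (hG.posPart hp)
    (fun n => sobolevCc_posPart hp (ha (ns n))) (fun n => (hA (ns n)).posPart hp)
    ((hau.comp hns).of_le fun n x => ?_) fun i => ?_
  · exact abs_max_sub_max_le_abs _ _ _
  have hm : ∀ n, ∀ w, MemLpOn Ω p w → MemLpOn Ω p ({x | 0 < a (ns n) x}.indicator w) :=
    fun n w hw => MemLp.mono hw
      (hw.1.indicator₀ (HasSobolevGrad.nullMeasurableSet_pos (hA (ns n)).memLp))
      (ae_of_all _ fun _ => norm_indicator_le_norm_self _ _)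
  have h1 : TendstoLp Ω p (fun n => {x | 0 < a (ns n) x}.indicator (A (ns n) i - G i)) 0 := by
    refine ((hAG i).comp hns).of_le fun n x => ?_
    rw [Pi.zero_apply, sub_zero]
    exact norm_indicator_le_norm_self (A (ns n) i - G i) x
  have h2 : TendstoLp Ω p (fun n => {x | 0 < a (ns n) x}.indicator (G i))
      ({x | 0 < u x}.indicator (G i)) := by
    refine (tendsto_eLpNorm_sub_of_dominated hp0 (B := fun x => ‖G i x‖ₑ ^ p)
      (fun n => (hm n _ (hG.memLp_grad i)).1) ?_ (fun n => ae_of_all _ fun x => ?_) ?_).2.2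
    · rw [← eLpNorm_rpow_eq_lintegral hp0]
      exact ENNReal.rpow_ne_top_of_nonneg hp0.le (hG.memLp_grad i).2.ne
    · exact ENNReal.rpow_le_rpow (enorm_indicator_le_enorm_self _ _) hp0.le
    · filter_upwards [hae, hG.ae_grad_eq_zero hp i] with x hx h0
      refine tendsto_const_nhds.congr' ?_
      -- The indicators stabilise where `u x ≠ 0`. Where `u x = 0` they may oscillate, but there the
      -- gradient vanishes.
      rcases lt_trichotomy (u x) 0 with h | h | h
      · filter_upwards [hx.eventually_lt_const h] with n hn
        simp [h.not_gt, hn.not_gt]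
      · simp [Set.indicator_apply, h0 h]
      · filter_upwards [hx.eventually_const_lt h] with n hn
        simp [h, hn]
  have h3 := h1.add hp h2 (fun n => hm n _ ((hA (ns n)).memLp_grad i |>.sub (hG.memLp_grad i)))
    (fun n => hm n _ (hG.memLp_grad i)) MemLp.zero
    ((hG.posPart hp).memLp_grad i)
  simpa [← Set.indicator_add'] using h3

/-- `sobolevTilde` is closed under maxima. -/
theorem sobolevTilde_max (hp : 1 ≤ p) (hu : u ∈ sobolevTilde Ω p) (hv : v ∈ sobolevTilde Ω p) :
    (fun x => max (u x) (v x)) ∈ sobolevTilde Ω p := by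
  have h := sobolevTilde_add hp hu
    (sobolevTilde_posPart hp (sobolevTilde_add hp hv (sobolevTilde_neg hp hu)))
  convert h using 1
  funext x
  simp only [Pi.add_apply, Pi.neg_apply]
  rw [← max_add_add_left, add_zero, max_comm]
  congr 1
  ring

open Classical in
theorem HasSobolevGrad.max (hp : 1 ≤ p) (hu : HasSobolevGrad Ω p u G)
    (hv : HasSobolevGrad Ω p v H) :
    HasSobolevGrad Ω p (fun x => max (u x) (v x))
      (fun i x => if u x < v x then H i x else G i x) := by
  have h := hu.add hp ((hv.sub hp hu).posPart hp)
  convert h using 1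
  · funext x
    simp only [Pi.add_apply, Pi.sub_apply]
    rw [← max_add_add_left, add_zero, max_comm]
    congr 1
    ring
  · funext i x
    simp only [Pi.add_apply, Set.indicator_apply, Set.mem_ofPred_eq, Pi.sub_apply, sub_pos]
    split_ifs <;> ring

end Tilde

/-! ### Suprema of sequences with summable norms -/

section Supremum

variable {N : ℕ} {Ω : Opens (RN N)} {p : ℝ} {u : ℕ → RN N → ℝ} {G : ℕ → Fin N → RN N → ℝ}

/-- The maximum of `u 0, …, u n`. -/
noncomputable def runningMax (u : ℕ → RN N → ℝ) : ℕ → RN N → ℝ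
  | 0 => u 0
  | n + 1 => fun x => max (runningMax u n x) (u (n + 1) x)

open Classical in
/-- The gradient of the maximum of `u 0, …, u n` in terms of the gradients `G` of `u`. -/
noncomputable def runningGrad (u : ℕ → RN N → ℝ) (G : ℕ → Fin N → RN N → ℝ) :
    ℕ → Fin N → RN N → ℝ
  | 0 => G 0
  | n + 1 => fun i x =>
      if runningMax u n x < u (n + 1) x then G (n + 1) i x else runningGrad u G n i x

theorem hasSobolevGrad_runningMax (hp : 1 ≤ p) (hu : ∀ k, HasSobolevGrad Ω p (u k) (G k))
    (n : ℕ) : HasSobolevGrad Ω p (runningMax u n) (runningGrad u G n) := by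
  induction n with
  | zero => exact hu 0
  | succ n ih => exact ih.max hp (hu (n + 1))

theorem runningMax_mem_sobolevTilde (hp : 1 ≤ p) (hu : ∀ k, u k ∈ sobolevTilde Ω p) (n : ℕ) :
    runningMax u n ∈ sobolevTilde Ω p := by
  induction n with
  | zero => exact hu 0
  | succ n ih => exact sobolevTilde_max hp ih (hu (n + 1))

/-- One index serves the value and all partial derivatives, so `p`-th powers of the running maximum
and its gradient are bounded by the sums over `k`, independently of `n`. -/
theorem exists_runningMax_eq (u : ℕ → RN N → ℝ) (G : ℕ → Fin N → RN N → ℝ) (n : ℕ) (x : RN N) :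
    ∃ k, runningMax u n x = u k x ∧ ∀ i, runningGrad u G n i x = G k i x := by
  induction n with
  | zero => exact ⟨0, rfl, fun _ => rfl⟩
  | succ n ih =>
    by_cases h : runningMax u n x < u (n + 1) x
    · exact ⟨n + 1, max_eq_right h.le, fun i => if_pos h⟩
    · obtain ⟨k, hk, hk'⟩ := ih
      exact ⟨k, (max_eq_left (not_lt.1 h)).trans hk, fun i => (if_neg h).trans (hk' i)⟩

theorem monotone_runningMax (u : ℕ → RN N → ℝ) (x : RN N) :
    Monotone fun n => runningMax u n x :=
  monotone_nat_of_le_succ fun _ => le_max_left _ _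

theorem le_runningMax (u : ℕ → RN N → ℝ) (k : ℕ) (x : RN N) : u k x ≤ runningMax u k x := by
  cases k with
  | zero => exact le_rfl
  | succ k => exact le_max_right _ _

/-- Where a sequence of nonnegative functions tends to `0`, its running maximum is eventually
constant. -/
theorem eventually_runningMax_eq {x : RN N} (h0 : ∀ k, 0 ≤ u k x)
    (hlim : Tendsto (fun k => u k x) atTop (𝓝 0)) :
    ∃ m, ∀ n, m ≤ n → runningMax u n x = runningMax u m x ∧
      ∀ i, runningGrad u G n i x = runningGrad u G m i x := by
  -- If some maximum is positive, later terms eventually stay below it. Otherwise all terms are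
  -- zero, and the strict inequality in `runningGrad` never switches the gradient.
  have key : ∃ m, ∀ n, m ≤ n → u (n + 1) x ≤ runningMax u n x := by
    by_cases h : ∃ m, 0 < runningMax u m x
    · obtain ⟨m, hm⟩ := h
      obtain ⟨m', hm'⟩ := eventually_atTop.1 (hlim.eventually_lt_const hm)
      refine ⟨max m m', fun n hn => ?_⟩
      exact (hm' (n + 1) (by have := le_of_max_le_right hn; omega)).le.trans
        (monotone_runningMax u x (le_of_max_le_left hn))
    · push Not at h
      refine ⟨0, fun n _ => ?_⟩
      exact ((le_runningMax u (n + 1) x).trans (h (n + 1))).trans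
        ((h0 0).trans (monotone_runningMax u x (Nat.zero_le n)))
  obtain ⟨m, hm⟩ := key
  refine ⟨m, fun n hn => ?_⟩
  induction n, hn using Nat.le_induction with
  | base => exact ⟨rfl, fun _ => rfl⟩
  | succ n hn ih =>
    exact ⟨(max_eq_left (hm n hn)).trans ih.1, fun i => (if_neg (hm n hn).not_gt).trans (ih.2 i)⟩

/-- The supremum of a sequence of nonnegative functions in `sobolevTilde` whose norms are summable
is in `sobolevTilde`. -/
theorem exists_mem_sobolevTilde_ge (hp : 1 ≤ p) (hu : ∀ k, u k ∈ sobolevTilde Ω p)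
    (h0 : ∀ k x, 0 ≤ u k x) (hsum : ∑' k, sobolevNormPow Ω p (u k) ≠ ∞) :
    ∃ w ∈ sobolevTilde Ω p, sobolevNormPow Ω p w ≤ ∑' k, sobolevNormPow Ω p (u k) ∧
      ∀ᵐ x ∂volume.restrict (Ω : Set (RN N)), ∀ k, u k x ≤ w x := by
  have hp0 : 0 < p := by linarith
  choose G hG using fun k => mem_sobolevSpace_iff.1 (hu k).1
  set μ := volume.restrict (Ω : Set (RN N))
  have hswap : ∀ f : ℕ → RN N → ℝ, (∀ k, MemLpOn Ω p (f k)) →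
      ∫⁻ x, ∑' k, ‖f k x‖ₑ ^ p ∂μ = ∑' k, eLpNorm (f k) (ENNReal.ofReal p) μ ^ p := by
    intro f hf
    rw [lintegral_tsum fun k => (hf k).1.enorm.pow_const p]
    exact tsum_congr fun k => (eLpNorm_rpow_eq_lintegral hp0 (f k)).symm
  have hsum_eq : ∑' k, sobolevNormPow Ω p (u k) = ∫⁻ x, ∑' k, ‖u k x‖ₑ ^ p ∂μ +
      ∑ i, ∫⁻ x, ∑' k, ‖G k i x‖ₑ ^ p ∂μ := by
    rw [hswap u fun k => (hG k).memLp]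
    simp_rw [fun i => hswap (fun k => G k i) fun k => (hG k).memLp_grad i]
    rw [← Summable.tsum_finsetSum fun _ _ => ENNReal.summable, ← ENNReal.tsum_add]
    exact tsum_congr fun k => (hG k).sobolevNormPow_eq hp
  rw [hsum_eq] at hsum ⊢
  obtain ⟨hsu, hsG⟩ := ENNReal.add_ne_top.1 hsum
  have hsG : ∀ i, ∫⁻ x, ∑' k, ‖G k i x‖ₑ ^ p ∂μ ≠ ∞ := fun i =>
    ENNReal.sum_ne_top.1 hsG i (Finset.mem_univ i)
  have hlim : ∀ᵐ x ∂μ, Tendsto (fun k => u k x) atTop (𝓝 0) := by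
    have hm : AEMeasurable (fun x => ∑' k, ‖u k x‖ₑ ^ p) μ :=
      AEMeasurable.tsum fun k => (hG k).memLp.1.enorm.pow_const p
    filter_upwards [ae_lt_top' hm hsu] with x hx
    have h1 := ENNReal.tendsto_atTop_zero_of_tsum_ne_top hx.ne
    have h2 := (ENNReal.continuous_rpow_const (y := 1 / p)).tendsto 0 |>.comp h1
    rw [ENNReal.zero_rpow_of_pos (by positivity)] at h2
    refine tendsto_zero_iff_enorm_tendsto_zero.2 (h2.congr fun k => by
      rw [Function.comp_apply, ← ENNReal.rpow_mul, mul_one_div_cancel hp0.ne', ENNReal.rpow_one])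
  -- `limUnder` takes an unspecified value where the limit fails to exist, which inside `Ω` happens
  -- only on a null set.
  let w : RN N → ℝ := fun x => limUnder atTop fun n => runningMax u n x
  let W : Fin N → RN N → ℝ := fun i x => limUnder atTop fun n => runningGrad u G n i x
  have hconv : ∀ᵐ x ∂μ, Tendsto (fun n => runningMax u n x) atTop (𝓝 (w x)) ∧
      ∀ i, Tendsto (fun n => runningGrad u G n i x) atTop (𝓝 (W i x)) := by
    filter_upwards [hlim] with x hx
    obtain ⟨m, hm⟩ := eventually_runningMax_eq (G := G) (fun k => h0 k x) hx
    exact ⟨tendsto_nhds_limUnder ⟨_, tendsto_const_nhds.congr'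
        (eventually_atTop.2 ⟨m, fun n hn => (hm n hn).1.symm⟩)⟩,
      fun i => tendsto_nhds_limUnder ⟨_, tendsto_const_nhds.congr'
        (eventually_atTop.2 ⟨m, fun n hn => ((hm n hn).2 i).symm⟩)⟩⟩
  have hrun := hasSobolevGrad_runningMax hp hG
  obtain ⟨hw1, hw2, hw3⟩ := tendsto_eLpNorm_sub_of_dominated (f := w) hp0
    (fun n => (hrun n).memLp.1) hsu
    (fun n => ae_of_all _ fun x => by
      obtain ⟨k, hk, -⟩ := exists_runningMax_eq u G n x
      rw [hk]
      exact ENNReal.le_tsum k)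
    (hconv.mono fun x hx => hx.1)
  have hW := fun i => tendsto_eLpNorm_sub_of_dominated (f := W i) hp0
    (fun n => ((hrun n).memLp_grad i).1) (hsG i)
    (fun n => ae_of_all _ fun x => by
      obtain ⟨k, -, hk⟩ := exists_runningMax_eq u G n x
      rw [hk i]
      exact ENNReal.le_tsum k)
    (hconv.mono fun x hx => hx.2 i)
  have hgrad : HasSobolevGrad Ω p w W := ⟨hw1, fun i => (hW i).1, fun i =>
    HasWeakPartialDeriv.of_tendsto hp (fun n => (hrun n).hasWeakPartialDeriv i)
      (fun n => (hrun n).memLp) (fun n => (hrun n).memLp_grad i) hw1 (hW i).1 hw3 (hW i).2.2⟩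
  refine ⟨w, mem_sobolevTilde_of_tendsto hp hgrad (runningMax_mem_sobolevTilde hp hu) hrun hw3
    fun i => (hW i).2.2, ?_, ?_⟩
  · rw [hgrad.sobolevNormPow_eq hp]
    exact add_le_add hw2 (Finset.sum_le_sum fun i _ => (hW i).2.1)
  · filter_upwards [hconv] with x hx k
    exact (le_runningMax u k x).trans ((monotone_runningMax u x).ge_of_tendsto hx.1 k)

theorem sobolevNormPow_posPart_le (hp : 1 ≤ p) {u : RN N → ℝ} (hu : u ∈ sobolevSpace Ω p) :
    sobolevNormPow Ω p (fun x => max (u x) 0) ≤ sobolevNormPow Ω p u := by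
  have hp0 : 0 ≤ p := by linarith
  obtain ⟨G, hG⟩ := mem_sobolevSpace_iff.1 hu
  rw [(hG.posPart hp).sobolevNormPow_eq hp, hG.sobolevNormPow_eq hp]
  refine add_le_add (ENNReal.rpow_le_rpow (eLpNorm_mono fun x => ?_) hp0)
    (Finset.sum_le_sum fun i _ => ENNReal.rpow_le_rpow (eLpNorm_mono fun x => ?_) hp0)
  · simpa using abs_max_sub_max_le_abs (u x) 0 0
  · exact norm_indicator_le_norm_self _ _

end Supremum

end RelCap

/-! ### Countable subadditivity -/

open RelCap in
theorem mainTheorem5 {N : ℕ} (Ω : Opens (RelCap.RN N)) (p : ℝ) (hp : 1 < p)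
    (A : ℕ → Set (closure (Ω : Set (RelCap.RN N)))) :
    RelCap.relCapacity Ω p (⋃ k, A k) ≤ ∑' k, RelCap.relCapacity Ω p (A k) := by
  -- This reduction also supplies finiteness of the sum, hence of each capacity, so that adding `δ
  -- k` is a strict increase and near-minimisers exist.
  refine ENNReal.le_of_forall_pos_le_add fun ε hε hfin => ?_
  obtain ⟨δ, hδ, hδε⟩ := ENNReal.exists_pos_sum_of_countable' (ENNReal.coe_pos.2 hε).ne' ℕ
  have hex : ∀ k, ∃ u ∈ admissible Ω p (A k),
      sobolevNormPow Ω p u < relCapacity Ω p (A k) + δ k := by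
    intro k
    have hlt : relCapacity Ω p (A k) < relCapacity Ω p (A k) + δ k :=
      ENNReal.lt_add_right (ENNReal.ne_top_of_tsum_ne_top hfin.ne k) (hδ k).ne'
    simpa only [relCapacity, iInf_lt_iff, exists_prop] using hlt
  choose u hu hlt using hex
  choose hut O hO hAO hOu using hu
  have hle : ∑' k, sobolevNormPow Ω p (fun x => max (u k x) 0) ≤
      ∑' k, relCapacity Ω p (A k) + ε := by
    refine (ENNReal.tsum_le_tsum fun k =>
      (sobolevNormPow_posPart_le hp.le (hut k).1).trans (hlt k).le).trans ?_
    rw [ENNReal.tsum_add]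
    gcongr
  obtain ⟨w, hw, hwle, hge⟩ := exists_mem_sobolevTilde_ge hp.le
    (fun k => sobolevTilde_posPart hp.le (hut k)) (fun k x => le_max_right _ _)
    (hle.trans_lt (ENNReal.add_lt_top.2 ⟨hfin, ENNReal.coe_lt_top⟩)).ne
  refine (iInf₂_le w ⟨hw, ⋃ k, O k, isOpen_iUnion hO, Set.iUnion_mono hAO, ?_⟩).trans
    (hwle.trans hle)
  rw [ae_restrict_iff' Ω.isOpen.measurableSet] at hge
  filter_upwards [hge, ae_all_iff.2 hOu] with x hx hxO
  rintro ⟨⟨y, hy, rfl⟩, hxΩ⟩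
  obtain ⟨k, hk⟩ := Set.mem_iUnion.1 hy
  exact (hxO k ⟨⟨y, hk, rfl⟩, hxΩ⟩).trans ((le_max_left _ _).trans (hx hxΩ k))
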